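/- All graphs are finite, simple and undirected. For a graph $G$ and a vertex $v$, let $N(v)$ be the set of neighbours of $v$ and $N[v]=N(v)\cup\{v\}$. A partial coloring of $G$ colors the vertices of some subset $V'\subseteq V(G)$; it is a CFON$^*$ (respectively CFCN$^*$) coloring if for every $v\in V(G)$ the set $N(v)$ (respectively $N[v]$) contains a colored vertex whose color differs from that of every other colored vertex in that set. A $k$-assignment gives every vertex $v$ a list $L_v$ of exactly $k$ colors. The choice number $ch^*_{ON}(G)$ (respectively $ch^*_{CN}(G)$) is the least positive integer $k$ such that for every $k$-assignment there is a CFON$^*$ (respectively CFCN$^*$) coloring in which every colored vertex $v$ gets a color from $L_v$. Let $c>0$ and $\epsilon\ge 0$ be real numbers. There is a constant $C>0$, depending only on $c$ and $\epsilon$, such that the following holds. Let $G$ be a graph with maximum degree $\Delta\ge 1$ and minimum degree at least $c\Delta/\ln^{\epsilon}\Delta$ (if $\Delta=1$ and $\epsilon>0$, this lower bound is void), and, for statement (i), without isolated vertices (this is automatic if $\Delta\ge 2$). Then the following choice numbers are finite and (i) $ch^*_{ON}(G)\le \frac{13088}{c}\ln^{1+\epsilon}(4\Delta)+866800$, and if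 $\Delta\ge 2$ then $ch^*_{ON}(G)\le C\ln^{1+\epsilon}\Delta$; (ii) $ch^*_{CN}(G)\le \frac{13088}{c}\ln^{1+\epsilon}(4\Delta)+866800$, and if $\Delta\ge 2$ then $ch^*_{CN}(G)\le C\ln^{1+\epsilon}\Delta$. -/

import Mathlib

universe u

namespace ListCF

/-- Under the partial coloring `f` (where `f v = none` means that `v` is uncolored), the set `S`
contains a colored vertex whose color is distinct from that of every other vertex of `S`. -/
def HasUniqueColor {V : Type u} (f : V → Option ℕ) (S : Set V) : Prop :=
  ∃ u ∈ S, ∃ a : ℕ, f u = some a ∧ ∀ w ∈ S, w ≠ u → f w ≠ some a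

/-- `f` is a partial conflict-free open neighborhood coloring of `G`. -/
def IsCFONStarColoring {V : Type u} (G : SimpleGraph V) (f : V → Option ℕ) : Prop :=
  ∀ v : V, HasUniqueColor f (G.neighborSet v)

/-- `f` is a partial conflict-free closed neighborhood coloring of `G`. -/
def IsCFCNStarColoring {V : Type u} (G : SimpleGraph V) (f : V → Option ℕ) : Prop :=
  ∀ v : V, HasUniqueColor f (insert v (G.neighborSet v))

/-- Every colored vertex receives a color from its own list. -/
def RespectsLists {V : Type u} (L : V → Finset ℕ) (f : V → Option ℕ) : Prop :=
  ∀ v : V, ∀ a : ℕ, f v = some a → a ∈ L v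

/-- `G` is `k`-choosable for partial conflict-free open neighborhood colorings: every assignment
of lists of exactly `k` colors admits such a coloring from the lists. -/
def IsCFONStarChoosable {V : Type u} (G : SimpleGraph V) (k : ℕ) : Prop :=
  ∀ L : V → Finset ℕ, (∀ v, (L v).card = k) →
    ∃ f : V → Option ℕ, RespectsLists L f ∧ IsCFONStarColoring G f

/-- `G` is `k`-choosable for partial conflict-free closed neighborhood colorings. -/
def IsCFCNStarChoosable {V : Type u} (G : SimpleGraph V) (k : ℕ) : Prop :=
  ∀ L : V → Finset ℕ, (∀ v, (L v).card = k) →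
    ∃ f : V → Option ℕ, RespectsLists L f ∧ IsCFCNStarColoring G f

/-- The minimum positive `k` for which `G` is `k`-CFON*-choosable (`⊤` if there is none, which
happens exactly when some vertex has an empty open neighborhood, for finite `G`). -/
noncomputable def chONStar {V : Type u} (G : SimpleGraph V) : ℕ∞ :=
  ⨅ (k : ℕ) (_ : 0 < k ∧ IsCFONStarChoosable G k), (k : ℕ∞)

/-- The minimum positive `k` for which `G` is `k`-CFCN*-choosable (`⊤` if there is none). -/
noncomputable def chCNStar {V : Type u} (G : SimpleGraph V) : ℕ∞ :=
  ⨅ (k : ℕ) (_ : 0 < k ∧ IsCFCNStarChoosable G k), (k : ℕ∞)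

end ListCF

/-!
Both choice numbers are bounded through the set systems of open, respectively closed, neighborhoods
(`exists_list_size`). Let `δ` and `Δ` be the minimum and maximum degree and `l = log (4Δ)`; the aim
is lists of size `O(l Δ / δ)`, since the degree condition says that `Δ / δ ≤ (log Δ) ^ ε / c`.

If `δ < 6 l`, then `Δ + 2` is already of this order, and a greedy coloring
(`exists_coloring_greedy`) works: the first colored vertex of each set stays unique there, and a
later vertex has to avoid at most one color for each of the at most `Δ + 1` sets containing it.

Otherwise color every vertex independently with probability `1 / q`, where `q = ⌊δ / (6 l)⌋`, and
then with a uniformly random color of its list. In a set without a unique color, every color occurs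
twice, so at least half of the colored vertices repeat an earlier color. While at most `U` vertices
of the set are colored and lists have `16 U` colors, a newly colored vertex repeats a color with
probability at most `1 / 16`, so the potential `4 ^ (repetitions - new colors)` shrinks on average
by the factor `1 - 1 / (2q)` per vertex exposed. This one potential accounts both for too few
colored vertices and for too many repetitions. More than `U = O(l Δ / δ)` colored vertices are
ruled out by the exponential moment `E[2 ^ X]` (`card_no_unique_le`). Both probabilities are at most
`(4Δ) ^ (-3)`, and every set meets at most `(Δ + 1) ^ 2` sets, so the symmetric Lovász local
lemma (`exists_notMem_of_local_lemma`) applies. All probabilities are stated as cardinalities in the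
finite sample space `V → Fin q × Fin k`.
-/

namespace ListCF

/-! ### The symmetric Lovász local lemma for uniform counting -/

/-- Symmetric local lemma for the uniform measure on a finite type. The bad event `B i` need only be
independent of avoiding any family of events outside `Γ i`; `Γ i` may contain `i` itself. -/
theorem exists_notMem_of_local_lemma {Ω ι : Type*} [Fintype Ω] [DecidableEq Ω] [Nonempty Ω]
    [Fintype ι] [DecidableEq ι] (B : ι → Finset Ω) (Γ : ι → Finset ι) (d : ℕ) (hd : 0 < d)
    (hΓ : ∀ i, (Γ i).card ≤ d)
    (hB : ∀ i, 4 * (d : ℝ) * (B i).card ≤ Fintype.card Ω)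
    (hind : ∀ i (T : Finset ι), Disjoint T (Γ i) →
      (B i ∩ Finset.univ.filter (fun ω => ∀ j ∈ T, ω ∉ B j)).card * Fintype.card Ω ≤
        (B i).card * (Finset.univ.filter (fun ω => ∀ j ∈ T, ω ∉ B j)).card) :
    ∃ ω, ∀ i, ω ∉ B i := by
  set good : Finset ι → Finset Ω := fun T => Finset.univ.filter (fun ω => ∀ j ∈ T, ω ∉ B j)
    with hgood
  have hd' : (1 : ℝ) ≤ d := by exact_mod_cast hd
  have hΩ : (0 : ℝ) < Fintype.card Ω := by exact_mod_cast Fintype.card_pos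
  -- Conditioned on avoiding the events in `T`, every bad event has probability at most `1 / (2d)`.
  have key : ∀ n : ℕ, ∀ T : Finset ι, T.card = n →
      0 < (good T).card ∧ ∀ i, 2 * (d : ℝ) * (B i ∩ good T).card ≤ (good T).card := by
    intro n
    induction n using Nat.strong_induction_on with
    | _ n ih =>
    intro T hT
    constructor
    · rcases T.eq_empty_or_nonempty with rfl | ⟨j, hj⟩
      · have : good ∅ = Finset.univ := by simp [hgood]
        rw [this]
        exact Finset.card_pos.2 Finset.univ_nonempty
      · have hlt : (T.erase j).card < n := hT ▸ Finset.card_erase_lt_of_mem hj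
        obtain ⟨h1, h2⟩ := ih _ hlt _ rfl
        have hsub : good (T.erase j) \ (B j ∩ good (T.erase j)) ⊆ good T := by
          intro ω hω
          simp only [hgood, Finset.mem_sdiff, Finset.mem_inter, Finset.mem_filter,
            Finset.mem_univ, true_and, Finset.mem_erase] at hω ⊢
          intro i hi
          by_cases hij : i = j
          · subst hij
            exact fun h => hω.2 ⟨h, hω.1⟩
          · exact hω.1 i ⟨hij, hi⟩
        have h3 := Finset.card_le_card hsub
        have h4 := Finset.card_sdiff_add_card_eq_card
          (Finset.inter_subset_right : B j ∩ good (T.erase j) ⊆ good (T.erase j))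
        have h5 := h2 j
        have h6 : 2 * (B j ∩ good (T.erase j)).card ≤ (good (T.erase j)).card := by
          have : (2 : ℝ) * (B j ∩ good (T.erase j)).card ≤ (good (T.erase j)).card := by
            refine le_trans ?_ h5
            have : (0 : ℝ) ≤ (B j ∩ good (T.erase j)).card := by positivity
            nlinarith
          exact_mod_cast this
        omega
    · intro i
      -- `B i` is independent of avoiding `T₂`, and avoiding `T₁` as well costs at most a factor `2`.
      set T₁ := T ∩ Γ i with hT₁
      set T₂ := T \ Γ i with hT₂
      have hsub : B i ∩ good T ⊆ B i ∩ good T₂ := by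
        refine Finset.inter_subset_inter_left fun ω hω => ?_
        simp only [hgood, Finset.mem_filter, Finset.mem_univ, true_and] at hω ⊢
        exact fun j hj => hω j (Finset.sdiff_subset hj)
      have h1 : ((B i ∩ good T).card : ℝ) ≤ (B i ∩ good T₂).card := by
        exact_mod_cast Finset.card_le_card hsub
      have h2 : ((B i ∩ good T₂).card : ℝ) * Fintype.card Ω ≤ (B i).card * (good T₂).card := by
        exact_mod_cast hind i T₂ Finset.sdiff_disjoint
      have h3 : 4 * (d : ℝ) * (B i ∩ good T₂).card ≤ (good T₂).card := by
        have h : (4 * (d : ℝ) * (B i ∩ good T₂).card) * Fintype.card Ω ≤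
            (good T₂).card * Fintype.card Ω := by
          have := mul_le_mul_of_nonneg_right (hB i)
            (by positivity : (0 : ℝ) ≤ (good T₂).card)
          nlinarith
        exact le_of_mul_le_mul_right h hΩ
      have hcover : good T₂ ⊆ good T ∪ T₁.biUnion (fun j => B j ∩ good T₂) := by
        intro ω hω
        by_cases h : ω ∈ good T
        · exact Finset.mem_union_left _ h
        · refine Finset.mem_union_right _ ?_
          have h' : ∃ j ∈ T, ω ∈ B j := by
            simpa [hgood] using h
          obtain ⟨j, hj, hωj⟩ := h'
          have hjΓ : j ∈ Γ i := by
            by_contra hjΓ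
            have := (Finset.mem_filter.1 hω).2 j (Finset.mem_sdiff.2 ⟨hj, hjΓ⟩)
            exact this hωj
          exact Finset.mem_biUnion.2
            ⟨j, Finset.mem_inter.2 ⟨hj, hjΓ⟩, Finset.mem_inter.2 ⟨hωj, hω⟩⟩
      have h4 : ((good T₂).card : ℝ) ≤ (good T).card + ∑ j ∈ T₁, ((B j ∩ good T₂).card : ℝ) := by
        have := (Finset.card_le_card hcover).trans ((Finset.card_union_le _ _).trans
          (Nat.add_le_add_left Finset.card_biUnion_le _))
        exact_mod_cast this
      have h5 : 2 * (d : ℝ) * ∑ j ∈ T₁, ((B j ∩ good T₂).card : ℝ) ≤ d * (good T₂).card := by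
        rw [Finset.mul_sum]
        calc ∑ j ∈ T₁, 2 * (d : ℝ) * ((B j ∩ good T₂).card : ℝ)
            ≤ ∑ j ∈ T₁, ((good T₂).card : ℝ) := by
              refine Finset.sum_le_sum fun j hj => ?_
              have hlt : T₂.card < n := by
                rw [← hT]
                refine Finset.card_lt_card (Finset.ssubset_iff_subset_ne.2
                  ⟨Finset.sdiff_subset, fun h => ?_⟩)
                have hj' := Finset.mem_inter.1 hj
                have : j ∈ T₂ := h ▸ hj'.1
                exact (Finset.mem_sdiff.1 this).2 hj'.2
              exact (ih _ hlt _ rfl).2 j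
          _ = T₁.card * ((good T₂).card : ℝ) := by simp
          _ ≤ d * (good T₂).card := by
              have : T₁.card ≤ d := (Finset.card_le_card Finset.inter_subset_right).trans (hΓ i)
              gcongr
      have h6 : ((good T₂).card : ℝ) ≤ 2 * (good T).card := by
        have h : (d : ℝ) * ((good T₂).card : ℝ) ≤ d * (2 * (good T).card) := by nlinarith
        exact le_of_mul_le_mul_left h (by linarith)
      have h7 : 2 * (d : ℝ) * (B i ∩ good T).card ≤ 2 * d * (B i ∩ good T₂).card := by gcongr
      linarith
  obtain ⟨ω, hω⟩ := Finset.card_pos.1 (key _ Finset.univ rfl).1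
  exact ⟨ω, fun i => (Finset.mem_filter.1 hω).2 i (Finset.mem_univ i)⟩

/-- Events determined by complementary sets of coordinates are independent: exchanging the
coordinates outside `S` of two points turns `(E ∩ F) × Ω` into `E × F`. -/
theorem card_inter_mul_card_of_determined {V A : Type*} [Fintype V] [DecidableEq V] [Fintype A]
    [DecidableEq A] (S : Finset V) (E F : Finset (V → A))
    (hE : ∀ x y : V → A, (∀ v ∈ S, x v = y v) → x ∈ E → y ∈ E)
    (hF : ∀ x y : V → A, (∀ v ∉ S, x v = y v) → x ∈ F → y ∈ F) :
    (E ∩ F).card * Fintype.card (V → A) = E.card * F.card := by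
  rw [← Finset.card_univ, ← Finset.card_product, ← Finset.card_product]
  refine Finset.card_nbij'
    (fun p => (S.piecewise p.1 p.2, S.piecewise p.2 p.1))
    (fun p => (S.piecewise p.1 p.2, S.piecewise p.2 p.1)) ?_ ?_ ?_ ?_
  · intro p hp
    simp only [Finset.coe_product, Set.mem_prod, Finset.mem_coe, Finset.mem_inter] at hp ⊢
    exact ⟨hE p.1 _ (fun v hv => by simp [hv]) hp.1.1, hF p.1 _ (fun v hv => by simp [hv]) hp.1.2⟩
  · intro p hp
    simp only [Finset.coe_product, Set.mem_prod, Finset.mem_coe, Finset.mem_inter,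
      Finset.mem_univ, and_true] at hp ⊢
    exact ⟨hE p.1 _ (fun v hv => by simp [hv]) hp.1, hF p.2 _ (fun v hv => by simp [hv]) hp.2⟩
  · intro p _
    ext v <;> by_cases hv : v ∈ S <;> simp [hv]
  · intro p _
    ext v <;> by_cases hv : v ∈ S <;> simp [hv]

/-! ### Exposing the coordinates of a product space one at a time -/

theorem sum_sum_update {V A : Type*} [Fintype V] [DecidableEq V] [Fintype A]
    (h : (V → A) → ℝ) (v : V) :
    ∑ ω, ∑ a, h (Function.update ω v a) = Fintype.card A * ∑ ω, h ω := by
  classical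
  have h1 : ∑ ω, ∑ a, h (Function.update ω v a)
      = ∑ p : (V → A) × A, h (Function.update p.1 v p.2) := by
    rw [Fintype.sum_prod_type]
  have h2 : ∑ p : (V → A) × A, h (Function.update p.1 v p.2) = ∑ p : (V → A) × A, h p.1 := by
    -- Swapping the coordinate at `v` with the second component is an involution.
    refine Finset.sum_nbij' (fun p => (Function.update p.1 v p.2, p.1 v))
      (fun p => (Function.update p.1 v p.2, p.1 v)) ?_ ?_ ?_ ?_ ?_ <;> simp
  rw [h1, h2, Fintype.sum_prod_type]
  simp [Finset.mul_sum]

/-- If a potential shrinks on average by the factor `r` whenever one more coordinate is exposed,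
then after exposing all of `S` its average has shrunk by `r ^ |S|`. -/
theorem sum_potential_le {V A : Type*} [Fintype V] [DecidableEq V] [Fintype A] [Nonempty A]
    (g : Finset V → (V → A) → ℝ) (r : ℝ) (hr : 0 ≤ r)
    (hstep : ∀ (T : Finset V) (v : V), v ∉ T → ∀ ω,
      ∑ a, g (insert v T) (Function.update ω v a) ≤ r * Fintype.card A * g T ω)
    (S : Finset V) :
    ∑ ω, g S ω ≤ r ^ S.card * ∑ ω, g ∅ ω := by
  have hA : (0 : ℝ) < Fintype.card A := by exact_mod_cast Fintype.card_pos
  induction S using Finset.induction_on with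
  | empty => simp
  | insert v T hv ih =>
    have h1 : Fintype.card A * ∑ ω, g (insert v T) ω ≤
        Fintype.card A * (r * ∑ ω, g T ω) := by
      rw [← sum_sum_update _ v]
      calc _ ≤ ∑ ω, r * Fintype.card A * g T ω := Finset.sum_le_sum fun ω _ => hstep T v hv ω
        _ = _ := by rw [← Finset.mul_sum]; ring
    have h2 := le_of_mul_le_mul_left h1 hA
    rw [Finset.card_insert_of_notMem hv, pow_succ']
    nlinarith [mul_le_mul_of_nonneg_left ih hr]

/-! ### Colored vertices and colors of a partial coloring -/

/-- The vertices of `T` that receive a color under `f`. -/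
def colored {V : Type*} (f : V → Option ℕ) (T : Finset V) : Finset V :=
  T.filter fun v => f v ≠ none

/-- The colors that `f` uses on `T`, each as an element `some a` of `Option ℕ`. -/
def colorsOn {V : Type*} (f : V → Option ℕ) (T : Finset V) : Finset (Option ℕ) :=
  (colored f T).image f

variable {V : Type*}

theorem colored_congr {f g : V → Option ℕ} {T : Finset V} (h : ∀ v ∈ T, f v = g v) :
    colored f T = colored g T :=
  Finset.filter_congr fun v hv => by rw [h v hv]

theorem colorsOn_congr {f g : V → Option ℕ} {T : Finset V} (h : ∀ v ∈ T, f v = g v) :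
    colorsOn f T = colorsOn g T := by
  unfold colorsOn
  rw [colored_congr h]
  exact Finset.image_congr fun v hv => (h v (Finset.mem_filter.1 hv).1).symm ▸ rfl

variable [DecidableEq V]

theorem colored_update {f : V → Option ℕ} {T : Finset V} {v : V} (hv : v ∉ T) (o : Option ℕ) :
    colored (Function.update f v o) T = colored f T :=
  colored_congr fun w hw => by
    rw [Function.update_of_ne (ne_of_mem_of_not_mem hw hv)]

theorem colorsOn_update {f : V → Option ℕ} {T : Finset V} {v : V} (hv : v ∉ T) (o : Option ℕ) :
    colorsOn (Function.update f v o) T = colorsOn f T :=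
  colorsOn_congr fun w hw => by
    rw [Function.update_of_ne (ne_of_mem_of_not_mem hw hv)]

theorem colored_insert_update_none {f : V → Option ℕ} {T : Finset V} {v : V} (hv : v ∉ T) :
    colored (Function.update f v none) (insert v T) = colored f T := by
  rw [← colored_update hv none, colored, Finset.filter_insert]
  simp [colored]

theorem colorsOn_insert_update_none {f : V → Option ℕ} {T : Finset V} {v : V} (hv : v ∉ T) :
    colorsOn (Function.update f v none) (insert v T) = colorsOn f T := by
  rw [← colorsOn_update hv none, colorsOn, colorsOn, colored_insert_update_none hv,
    colored_update hv]

theorem colored_insert_update_some {f : V → Option ℕ} {T : Finset V} {v : V} (hv : v ∉ T) (a : ℕ) :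
    colored (Function.update f v (some a)) (insert v T) = insert v (colored f T) := by
  rw [← colored_update hv (some a), colored, Finset.filter_insert]
  simp [colored]

theorem colorsOn_insert_update_some {f : V → Option ℕ} {T : Finset V} {v : V} (hv : v ∉ T)
    (a : ℕ) :
    colorsOn (Function.update f v (some a)) (insert v T) = insert (some a) (colorsOn f T) := by
  rw [← colorsOn_update hv (some a), colorsOn, colorsOn, colored_insert_update_some hv,
    colored_update hv, Finset.image_insert, Function.update_self]

theorem card_colored_insert_update_some {f : V → Option ℕ} {T : Finset V} {v : V} (hv : v ∉ T)
    (a : ℕ) :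
    (colored (Function.update f v (some a)) (insert v T)).card = (colored f T).card + 1 := by
  rw [colored_insert_update_some hv, Finset.card_insert_of_notMem]
  exact fun h => hv (Finset.mem_filter.1 h).1

theorem two_mul_card_colorsOn_le {f : V → Option ℕ} {S : Finset V}
    (h : ¬ HasUniqueColor f (S : Set V)) :
    2 * (colorsOn f S).card ≤ (colored f S).card := by
  refine Finset.mul_card_image_le_card _ _ fun o ho => ?_
  obtain ⟨u, hu, rfl⟩ := Finset.mem_image.1 ho
  obtain ⟨huS, hune⟩ := Finset.mem_filter.1 hu
  obtain ⟨a, ha⟩ := Option.ne_none_iff_exists'.1 hune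
  have : ∃ w ∈ S, w ≠ u ∧ f w = some a := by
    by_contra hcon
    push Not at hcon
    exact h ⟨u, huS, a, ha, hcon⟩
  obtain ⟨w, hwS, hwu, hwa⟩ := this
  rw [Nat.succ_le_iff, Finset.one_lt_card]
  refine ⟨u, ?_, w, ?_, hwu.symm⟩
  · simp [hu]
  · simp [colored, hwS, hwa, ha]

/-! ### The potentials -/

/-- The repetition potential: as long as at most `U` vertices of `T` are colored, it is
`4 ^ (repetitions - new colors)`, where a set with `X` colored vertices and `Y` colors has
`X - Y` repetitions. It is at least `1` if no color is unique. -/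
noncomputable def repPotential (U : ℕ) (T : Finset V) (f : V → Option ℕ) : ℝ :=
  if (colored f T).card ≤ U then 4 ^ (colored f T).card / 16 ^ (colorsOn f T).card else 0

theorem repPotential_nonneg {V : Type*} (U : ℕ) (T : Finset V) (f : V → Option ℕ) :
    0 ≤ repPotential U T f := by
  unfold repPotential
  split_ifs <;> positivity

theorem repPotential_insert_none (U : ℕ) {T : Finset V} {v : V} (hv : v ∉ T) (f : V → Option ℕ) :
    repPotential U (insert v T) (Function.update f v none) = repPotential U T f := by
  simp only [repPotential, colored_insert_update_none hv, colorsOn_insert_update_none hv]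

/-- A new color divides the repetition potential by `4`, a repeated one multiplies it by `4`. -/
theorem repPotential_insert_some_le (U : ℕ) {T : Finset V} {v : V} (hv : v ∉ T)
    (f : V → Option ℕ) (a : ℕ) :
    repPotential U (insert v T) (Function.update f v (some a)) ≤
      (1 / 4 + if some a ∈ colorsOn f T then 4 else 0) * repPotential U T f := by
  have h0 := repPotential_nonneg U T f
  unfold repPotential at h0 ⊢
  rw [card_colored_insert_update_some hv, colorsOn_insert_update_some hv]
  by_cases hU : (colored f T).card + 1 ≤ U
  · have hU' : (colored f T).card ≤ U := by omega
    rw [if_pos hU, if_pos hU'] at *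
    split_ifs with hmem
    · rw [Finset.insert_eq_of_mem hmem, pow_succ]
      rw [show (4 : ℝ) ^ (colored f T).card * 4 / 16 ^ (colorsOn f T).card =
        4 * (4 ^ (colored f T).card / 16 ^ (colorsOn f T).card) by ring]
      linarith
    · rw [Finset.card_insert_of_notMem hmem, pow_succ, pow_succ]
      apply le_of_eq
      field_simp
      norm_num
  · rw [if_neg hU]
    refine mul_nonneg ?_ h0
    split_ifs <;> norm_num

theorem repPotential_empty {V : Type*} (U : ℕ) (f : V → Option ℕ) : repPotential U ∅ f = 1 := by
  simp [repPotential, colored, colorsOn]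

theorem one_le_repPotential {U : ℕ} {S : Finset V} {f : V → Option ℕ}
    (h : ¬ HasUniqueColor f (S : Set V)) (hU : (colored f S).card ≤ U) :
    1 ≤ repPotential U S f := by
  rw [repPotential, if_pos hU, one_le_div (by positivity)]
  calc (16 : ℝ) ^ (colorsOn f S).card = 4 ^ (2 * (colorsOn f S).card) := by
        rw [pow_mul]; norm_num
    _ ≤ 4 ^ (colored f S).card :=
        pow_le_pow_right₀ (by norm_num) (two_mul_card_colorsOn_le h)

theorem card_colorsOn_mul_repPotential_le {V : Type*} (U : ℕ) (T : Finset V) (f : V → Option ℕ) :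
    (colorsOn f T).card * repPotential U T f ≤ U * repPotential U T f := by
  by_cases hU : (colored f T).card ≤ U
  · have : (colorsOn f T).card ≤ U := Finset.card_image_le.trans hU
    have h0 := repPotential_nonneg U T f
    gcongr
  · simp [repPotential, hU]

/-! ### Random partial colorings from lists -/

/-- The partial coloring given by a sample point: `v` is colored when the first component of
`ω v` is `0`, and then it gets the color whose index in the enumeration `c v` of its list is the
second component. Under the uniform measure, a vertex is colored with probability `1 / (n + 1)`. -/
def sampleColoring {n k : ℕ} (c : V → Fin k → ℕ) (ω : V → Fin (n + 1) × Fin k) (v : V) :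
    Option ℕ :=
  if (ω v).1 = 0 then some (c v (ω v).2) else none

theorem sampleColoring_update {n k : ℕ} (c : V → Fin k → ℕ) (ω : V → Fin (n + 1) × Fin k) (v : V)
    (a : Fin (n + 1) × Fin k) :
    sampleColoring c (Function.update ω v a) =
      Function.update (sampleColoring c ω) v (if a.1 = 0 then some (c v a.2) else none) := by
  ext1 w
  by_cases h : w = v
  · subst h; simp [sampleColoring]
  · simp [sampleColoring, h]

theorem repPotential_step {n k U : ℕ} (hk : 16 * U ≤ k) (c : V → Fin k → ℕ)
    (hc : ∀ v, Function.Injective (c v)) {T : Finset V} {v : V} (hv : v ∉ T)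
    (ω : V → Fin (n + 1) × Fin k) :
    ∑ a, repPotential U (insert v T) (sampleColoring c (Function.update ω v a)) ≤
      (1 - 1 / (2 * ((n : ℝ) + 1))) * Fintype.card (Fin (n + 1) × Fin k) *
        repPotential U T (sampleColoring c ω) := by
  set f := sampleColoring c ω
  set g := repPotential U T f with hg
  have hg0 : 0 ≤ g := repPotential_nonneg U T f
  rw [Fintype.sum_prod_type, Fin.sum_univ_succ]
  have h1 : ∑ j : Fin k, repPotential U (insert v T)
      (sampleColoring c (Function.update ω v (0, j))) ≤ k * g / 2 := by
    have hcount : ((Finset.univ.filter fun j => some (c v j) ∈ colorsOn f T).card : ℝ) ≤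
        (colorsOn f T).card := by
      have := Finset.card_le_card_of_injOn (s := Finset.univ.filter fun j =>
        some (c v j) ∈ colorsOn f T) (t := colorsOn f T) (fun j => some (c v j))
        (fun j hj => (Finset.mem_filter.1 hj).2)
        (fun i _ j _ hij => hc v (Option.some_injective _ hij))
      exact_mod_cast this
    have hk' : 16 * (U : ℝ) ≤ k := by exact_mod_cast hk
    calc _ ≤ ∑ j : Fin k, (1 / 4 + if some (c v j) ∈ colorsOn f T then (4 : ℝ) else 0) * g := by
          refine Finset.sum_le_sum fun j _ => ?_
          rw [sampleColoring_update]
          exact repPotential_insert_some_le U hv f _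
      _ = k * g / 4 + 4 * ((Finset.univ.filter fun j => some (c v j) ∈ colorsOn f T).card * g) := by
          rw [← Finset.sum_mul, Finset.sum_add_distrib, ← Finset.sum_filter]
          simp
          ring
      _ ≤ k * g / 4 + 4 * (U * g) := by
          have := (mul_le_mul_of_nonneg_right hcount hg0).trans
            (card_colorsOn_mul_repPotential_le U T f)
          linarith
      _ ≤ k * g / 2 := by nlinarith
  have h2 : ∑ i : Fin n, ∑ j : Fin k, repPotential U (insert v T)
      (sampleColoring c (Function.update ω v (i.succ, j))) = n * (k * g) := by
    simp only [sampleColoring_update, Fin.succ_ne_zero, if_false, repPotential_insert_none U hv]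
    simp [f, hg]
  rw [h2]
  refine (add_le_add_left h1 _).trans (le_of_eq ?_)
  simp only [Fintype.card_prod, Fintype.card_fin]
  push_cast
  field_simp
  ring

theorem two_pow_colored_step {n k : ℕ} (c : V → Fin k → ℕ) {T : Finset V} {v : V} (hv : v ∉ T)
    (ω : V → Fin (n + 1) × Fin k) :
    ∑ a, (2 : ℝ) ^ (colored (sampleColoring c (Function.update ω v a)) (insert v T)).card ≤
      (1 + 1 / ((n : ℝ) + 1)) * Fintype.card (Fin (n + 1) × Fin k) *
        2 ^ (colored (sampleColoring c ω) T).card := by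
  rw [Fintype.sum_prod_type, Fin.sum_univ_succ]
  simp only [sampleColoring_update, Fin.succ_ne_zero, if_false, if_true,
    card_colored_insert_update_some hv, colored_insert_update_none hv]
  apply le_of_eq
  simp only [Finset.sum_const, Finset.card_univ, Fintype.card_prod, Fintype.card_fin, nsmul_eq_mul]
  push_cast
  field_simp
  ring

open Classical in
/-- The probability that a sample coloring has no unique color on `S`: the first term bounds the
case of at most `U` colored vertices, the second the case of more than `U`. -/
theorem card_no_unique_le [Fintype V] {n k U : ℕ} (hk0 : 0 < k) (hk : 16 * U ≤ k)
    (c : V → Fin k → ℕ) (hc : ∀ v, Function.Injective (c v)) (S : Finset V) :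
    ((Finset.univ.filter fun ω : V → Fin (n + 1) × Fin k =>
        ¬ HasUniqueColor (sampleColoring c ω) (S : Set V)).card : ℝ) ≤
      ((1 - 1 / (2 * ((n : ℝ) + 1))) ^ S.card + (1 + 1 / ((n : ℝ) + 1)) ^ S.card / 2 ^ U) *
        Fintype.card (V → Fin (n + 1) × Fin k) := by
  have : Nonempty (Fin k) := ⟨⟨0, hk0⟩⟩
  have hr : (0 : ℝ) ≤ 1 - 1 / (2 * ((n : ℝ) + 1)) := by
    rw [sub_nonneg, div_le_one (by positivity)]
    have : (0 : ℝ) ≤ n := by positivity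
    linarith
  have h1 := sum_potential_le
    (fun T (ω : V → Fin (n + 1) × Fin k) => repPotential U T (sampleColoring c ω)) _ hr
    (fun T v hv ω => repPotential_step hk c hc hv ω) S
  have h2 := sum_potential_le
    (fun T (ω : V → Fin (n + 1) × Fin k) => (2 : ℝ) ^ (colored (sampleColoring c ω) T).card)
    (1 + 1 / ((n : ℝ) + 1)) (by positivity) (fun T v hv ω => two_pow_colored_step c hv ω) S
  have h3 : ((Finset.univ.filter fun ω : V → Fin (n + 1) × Fin k =>
        ¬ HasUniqueColor (sampleColoring c ω) (S : Set V)).card : ℝ) ≤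
      ∑ ω : V → Fin (n + 1) × Fin k, (repPotential U S (sampleColoring c ω) +
        2 ^ (colored (sampleColoring c ω) S).card / 2 ^ U) := by
    rw [Finset.card_filter]
    push_cast
    refine Finset.sum_le_sum fun ω _ => ?_
    have h0 := repPotential_nonneg U S (sampleColoring c ω)
    split_ifs with h
    · positivity
    · by_cases hU : (colored (sampleColoring c ω) S).card ≤ U
      · have := one_le_repPotential h hU
        have : (0 : ℝ) ≤ 2 ^ (colored (sampleColoring c ω) S).card / 2 ^ U := by positivity
        linarith
      · have : (1 : ℝ) ≤ 2 ^ (colored (sampleColoring c ω) S).card / 2 ^ U := by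
          rw [one_le_div (by positivity)]
          exact pow_le_pow_right₀ (by norm_num) (by omega)
        linarith
  refine h3.trans ?_
  rw [Finset.sum_add_distrib, ← Finset.sum_div]
  simp only [repPotential_empty] at h1
  have h4 : ∑ ω : V → Fin (n + 1) × Fin k, (2 : ℝ) ^ (colored (sampleColoring c ω) ∅).card =
      Fintype.card (V → Fin (n + 1) × Fin k) := by
    simp [colored]
  rw [h4] at h2
  have h5 : ∑ ω : V → Fin (n + 1) × Fin k, (1 : ℝ) = Fintype.card (V → Fin (n + 1) × Fin k) := by
    simp
  rw [h5] at h1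
  rw [add_mul, div_mul_eq_mul_div]
  gcongr

/-! ### Conflict-free list colorings of set systems -/

theorem HasUniqueColor.congr {V : Type*} {f g : V → Option ℕ} {S : Set V}
    (h : ∀ v ∈ S, f v = g v) (hf : HasUniqueColor f S) : HasUniqueColor g S := by
  obtain ⟨u, hu, a, ha, hw⟩ := hf
  exact ⟨u, hu, a, (h u hu) ▸ ha, fun w hwS hne => (h w hwS) ▸ hw w hwS hne⟩

/-- Greedy coloring: if every point is in at most `D` sets, lists of `D + 1` colors suffice.
Points are colored one at a time; the first colored point of a set keeps its color unique there,
as each later point only has to avoid the colors of the first points of the sets containing it. -/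
theorem exists_coloring_greedy {V : Type*} [Fintype V] (S : V → Finset V) (D : ℕ)
    [DecidableEq V] (hS : ∀ v, (S v).Nonempty)
    (hdeg : ∀ x, (Finset.univ.filter fun v => x ∈ S v).card ≤ D)
    (L : V → Finset ℕ) (hL : ∀ v, D < (L v).card) :
    ∃ f : V → Option ℕ, RespectsLists L f ∧ ∀ v, HasUniqueColor f (S v : Set V) := by
  have key : ∀ T : Finset V, ∃ f : V → ℕ, (∀ v, f v ∈ L v) ∧
      ∀ e, (S e ∩ T).Nonempty → ∃ u ∈ S e ∩ T, ∀ w ∈ S e ∩ T, w ≠ u → f w ≠ f u := by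
    intro T
    induction T using Finset.induction_on with
    | empty =>
      have : ∀ v, ∃ a, a ∈ L v := fun v => Finset.card_pos.1 (by have := hL v; omega)
      choose f hf using this
      exact ⟨f, hf, fun e he => by simp at he⟩
    | insert x T hx ih =>
      obtain ⟨f, hfL, hf⟩ := ih
      have : ∀ e, ∃ u, (S e ∩ T).Nonempty →
          u ∈ S e ∩ T ∧ ∀ w ∈ S e ∩ T, w ≠ u → f w ≠ f u := by
        intro e
        by_cases he : (S e ∩ T).Nonempty
        · obtain ⟨u, hu⟩ := hf e he
          exact ⟨u, fun _ => hu⟩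
        · exact ⟨x, fun h => absurd h he⟩
      choose r hr using this
      obtain ⟨a, haL, ha⟩ : ∃ a ∈ L x,
          a ∉ (Finset.univ.filter fun v => x ∈ S v).image fun e => f (r e) :=
        Finset.exists_mem_notMem_of_card_lt_card
          ((Finset.card_image_le.trans (hdeg x)).trans_lt (hL x))
      have ha' : ∀ e, x ∈ S e → f (r e) ≠ a := fun e he h =>
        ha (Finset.mem_image.2 ⟨e, by simpa using he, h⟩)
      refine ⟨Function.update f x a, fun v => ?_, fun e he => ?_⟩
      · by_cases hv : v = x
        · subst hv; simpa using haL
        · simpa [hv] using hfL v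
      · by_cases heT : (S e ∩ T).Nonempty
        · obtain ⟨hrm, hru⟩ := hr e heT
          have hrx : r e ≠ x := ne_of_mem_of_not_mem (Finset.mem_inter.1 hrm).2 hx
          refine ⟨r e, ?_, fun w hw hwr => ?_⟩
          · exact Finset.mem_inter.2
              ⟨(Finset.mem_inter.1 hrm).1, Finset.mem_insert_of_mem (Finset.mem_inter.1 hrm).2⟩
          · rw [Function.update_of_ne hrx]
            obtain ⟨hwS, hwT⟩ := Finset.mem_inter.1 hw
            by_cases hwx : w = x
            · subst hwx
              rw [Function.update_self]
              exact (ha' e hwS).symm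
            · rw [Function.update_of_ne hwx]
              exact hru w (Finset.mem_inter.2 ⟨hwS, Finset.mem_of_mem_insert_of_ne hwT hwx⟩) hwr
        · have honly : ∀ w ∈ S e ∩ insert x T, w = x := by
            intro w hw
            by_contra hwx
            obtain ⟨hwS, hwT⟩ := Finset.mem_inter.1 hw
            exact heT ⟨w, Finset.mem_inter.2 ⟨hwS, Finset.mem_of_mem_insert_of_ne hwT hwx⟩⟩
          obtain ⟨w, hw⟩ := he
          exact ⟨w, hw, fun w' hw' hne => absurd ((honly w' hw').trans (honly w hw).symm) hne⟩
  obtain ⟨f, hfL, hf⟩ := key Finset.univ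
  refine ⟨fun v => some (f v), fun v a h => ?_, fun v => ?_⟩
  · obtain rfl := Option.some_injective _ h
    exact hfL v
  · obtain ⟨u, hu, hw⟩ := hf v (by simpa using hS v)
    rw [Finset.inter_univ] at hu hw
    exact ⟨u, hu, f u, rfl, fun w hwS hne h => hw w hwS hne (Option.some_injective _ h)⟩

open Classical in
/-- Random coloring and the local lemma: if each set fails to have a unique color with small
enough probability, then lists of `k` colors suffice. -/
theorem exists_coloring_of_prob_le {V : Type*} [Fintype V] (S : V → Finset V) (D n k U : ℕ)
    (hD : 0 < D) (hk0 : 0 < k) (hk : 16 * U ≤ k)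
    (hcard : ∀ v, (S v).card ≤ D)
    (hdeg : ∀ x, (Finset.univ.filter fun v => x ∈ S v).card ≤ D)
    (hprob : ∀ v, 4 * (D : ℝ) ^ 2 *
      ((1 - 1 / (2 * ((n : ℝ) + 1))) ^ (S v).card +
        (1 + 1 / ((n : ℝ) + 1)) ^ (S v).card / 2 ^ U) ≤ 1)
    (L : V → Finset ℕ) (hL : ∀ v, (L v).card = k) :
    ∃ f : V → Option ℕ, RespectsLists L f ∧ ∀ v, HasUniqueColor f (S v : Set V) := by
  have : Nonempty (Fin k) := ⟨⟨0, hk0⟩⟩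
  let c : V → Fin k → ℕ := fun v => (L v).orderEmbOfFin (hL v)
  have hc : ∀ v, Function.Injective (c v) := fun v => ((L v).orderEmbOfFin (hL v)).injective
  let B : V → Finset (V → Fin (n + 1) × Fin k) := fun v =>
    Finset.univ.filter fun ω => ¬ HasUniqueColor (sampleColoring c ω) (S v : Set V)
  let Γ : V → Finset V := fun i => Finset.univ.filter fun j => ¬ Disjoint (S i) (S j)
  have hdet : ∀ v (x y : V → Fin (n + 1) × Fin k), (∀ w ∈ S v, x w = y w) → x ∈ B v → y ∈ B v := by
    intro v x y hxy hx
    simp only [B, Finset.mem_filter, Finset.mem_univ, true_and] at hx ⊢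
    refine fun hy => hx (hy.congr fun w hw => ?_)
    simp [sampleColoring, hxy w hw]
  obtain ⟨ω, hω⟩ := exists_notMem_of_local_lemma B Γ (D ^ 2) (by positivity)
    (by
      intro i
      have hsub : Γ i ⊆ (S i).biUnion fun x => Finset.univ.filter fun v => x ∈ S v := by
        intro j hj
        obtain ⟨x, hxi, hxj⟩ := Finset.not_disjoint_iff.1 (Finset.mem_filter.1 hj).2
        exact Finset.mem_biUnion.2 ⟨x, hxi, by simpa using hxj⟩
      calc (Γ i).card ≤ (S i).card * D :=
            (Finset.card_le_card hsub).trans (Finset.card_biUnion_le_card_mul _ _ _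
              fun x _ => hdeg x)
        _ ≤ D ^ 2 := by rw [sq]; exact Nat.mul_le_mul_right _ (hcard i))
    (by
      intro i
      have h1 := card_no_unique_le (n := n) hk0 hk c hc (S i)
      have h2 := mul_le_mul_of_nonneg_right (hprob i)
        (by positivity : (0 : ℝ) ≤ Fintype.card (V → Fin (n + 1) × Fin k))
      push_cast
      have h3 := mul_le_mul_of_nonneg_left h1 (by positivity : (0 : ℝ) ≤ 4 * (D : ℝ) ^ 2)
      refine h3.trans (le_trans (le_of_eq ?_) (h2.trans (le_of_eq (one_mul _))))
      rw [mul_assoc (4 * (D : ℝ) ^ 2)])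
    (by
      intro i T hT
      refine (card_inter_mul_card_of_determined (S i) _ _ (hdet i) ?_).le
      intro x y hxy hx
      simp only [Finset.mem_filter, Finset.mem_univ, true_and] at hx ⊢
      refine fun j hj hyj => hx j hj (hdet j y x (fun w hw => (hxy w fun hwi => ?_).symm) hyj)
      exact Finset.disjoint_left.1 hT hj
        (Finset.mem_filter.2 ⟨Finset.mem_univ _, Finset.not_disjoint_iff.2 ⟨w, hwi, hw⟩⟩))
  refine ⟨sampleColoring c ω, fun v a h => ?_, fun v => ?_⟩
  · unfold sampleColoring at h
    split_ifs at h
    obtain rfl := Option.some_injective _ h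
    exact Finset.orderEmbOfFin_mem _ _ _
  · by_contra h
    exact hω v (Finset.mem_filter.2 ⟨Finset.mem_univ _, h⟩)

/-- The failure probability when vertices are colored with probability `1 / q`, where
`q = n + 1 = ⌊δ / (6 l)⌋` and `l = log (4Δ)`. -/
theorem failure_prob_le {δ Δ n m U : ℕ} {l : ℝ} (hδ : 1 ≤ δ) (hδΔ : δ ≤ Δ)
    (hl : l = Real.log (4 * (Δ : ℝ))) (hl1 : 1 ≤ l)
    (hn : ((n : ℝ) + 1) * (6 * l) ≤ δ) (hn' : (δ : ℝ) ≤ 2 * ((n : ℝ) + 1) * (6 * l))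
    (hU : 54 * l * (Δ / δ) ≤ (U : ℝ)) (hm : δ ≤ m) (hm' : m ≤ Δ + 1) :
    4 * ((Δ + 1 : ℕ) : ℝ) ^ 2 *
      ((1 - 1 / (2 * ((n : ℝ) + 1))) ^ m + (1 + 1 / ((n : ℝ) + 1)) ^ m / 2 ^ U) ≤ 1 := by
  set q : ℝ := (n : ℝ) + 1 with hq
  have hq1 : 1 ≤ q := by rw [hq]; linarith [(Nat.cast_nonneg n : (0 : ℝ) ≤ n)]
  have hδ' : (1 : ℝ) ≤ δ := by exact_mod_cast hδ
  have hδΔ' : (δ : ℝ) ≤ Δ := by exact_mod_cast hδΔ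
  have hΔ1 : (1 : ℝ) ≤ Δ := hδ'.trans hδΔ'
  have hmr : (δ : ℝ) ≤ m := by exact_mod_cast hm
  have hmr' : (m : ℝ) ≤ Δ + 1 := by exact_mod_cast hm'
  have hR : 1 ≤ (Δ : ℝ) / δ := by rw [one_le_div (by linarith)]; exact hδΔ'
  have hfirst : (1 - 1 / (2 * q)) ^ m ≤ Real.exp (-(3 * l)) := by
    have h0 : 0 ≤ 1 - 1 / (2 * q) := by
      rw [sub_nonneg, div_le_one (by positivity)]; linarith
    calc (1 - 1 / (2 * q)) ^ m ≤ Real.exp (-(1 / (2 * q))) ^ m :=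
          pow_le_pow_left₀ h0 (Real.one_sub_le_exp_neg _) m
      _ = Real.exp (-(m / (2 * q))) := by rw [← Real.exp_nat_mul]; ring_nf
      _ ≤ Real.exp (-(3 * l)) := by
          rw [Real.exp_le_exp, neg_le_neg_iff, le_div_iff₀ (by positivity)]
          linarith
  have hsecond : (1 + 1 / q) ^ m / 2 ^ U ≤ Real.exp (-(3 * l)) := by
    have h1 : (1 + 1 / q) ^ m ≤ Real.exp (24 * l * (Δ / δ)) := by
      calc (1 + 1 / q) ^ m ≤ Real.exp (1 / q) ^ m := by
            refine pow_le_pow_left₀ (by positivity) ?_ m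
            rw [add_comm]; exact Real.add_one_le_exp _
        _ = Real.exp (m / q) := by rw [← Real.exp_nat_mul]; ring_nf
        _ ≤ Real.exp (24 * l * (Δ / δ)) := by
            rw [Real.exp_le_exp, ← mul_div_assoc, div_le_div_iff₀ (by positivity) (by positivity)]
            calc (m : ℝ) * δ ≤ (2 * Δ) * (2 * q * (6 * l)) := by
                  gcongr
                  linarith
              _ = 24 * l * Δ * q := by ring
    have h2 : Real.exp (27 * l * (Δ / δ)) ≤ 2 ^ U := by
      -- `exp (1/2) ≤ 2` because `1/2 ≤ log 2`.
      have h : Real.exp (1 / 2) ≤ 2 := by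
        rw [← Real.le_log_iff_exp_le (by norm_num)]
        linarith [Real.log_two_gt_d9]
      calc Real.exp (27 * l * (Δ / δ)) ≤ Real.exp (U * (1 / 2)) := by
            rw [Real.exp_le_exp]; linarith
        _ = Real.exp (1 / 2) ^ U := Real.exp_nat_mul _ _
        _ ≤ 2 ^ U := pow_le_pow_left₀ (Real.exp_pos _).le h U
    rw [div_le_iff₀ (by positivity)]
    calc (1 + 1 / q) ^ m ≤ Real.exp (24 * l * (Δ / δ)) := h1
      _ ≤ Real.exp (-(3 * l)) * Real.exp (27 * l * (Δ / δ)) := by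
          rw [← Real.exp_add, Real.exp_le_exp]
          nlinarith
      _ ≤ _ := by gcongr
  have hexp : Real.exp (-(3 * l)) = ((4 * (Δ : ℝ)) ^ 3)⁻¹ := by
    rw [Real.exp_neg, show (3 : ℝ) * l = (3 : ℕ) * l by norm_num, Real.exp_nat_mul, hl,
      Real.exp_log (by positivity)]
  rw [hexp] at hfirst hsecond
  calc 4 * ((Δ + 1 : ℕ) : ℝ) ^ 2 * ((1 - 1 / (2 * q)) ^ m + (1 + 1 / q) ^ m / 2 ^ U)
      ≤ 4 * (2 * (Δ : ℝ)) ^ 2 * (((4 * (Δ : ℝ)) ^ 3)⁻¹ + ((4 * (Δ : ℝ)) ^ 3)⁻¹) := by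
        refine mul_le_mul ?_ (add_le_add hfirst hsecond) ?_ (by positivity)
        · push_cast
          gcongr
          linarith
        · have : 0 ≤ 1 - 1 / (2 * q) := by
            rw [sub_nonneg, div_le_one (by positivity)]; linarith
          positivity
    _ = 1 / (2 * (Δ : ℝ)) := by field_simp; norm_num
    _ ≤ 1 := by rw [div_le_one (by positivity)]; linarith

open Classical in
/-- A system of sets of size between `δ` and `Δ + 1` in which every point has degree at most
`Δ + 1` has conflict-free colorings from all lists of size `O(log (4Δ) Δ / δ)`. If `δ` is below
`6 log (4Δ)`, greedy coloring already achieves this. -/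
theorem exists_list_size {V : Type*} [Fintype V] (S : V → Finset V) (δ Δ : ℕ) (hδ : 1 ≤ δ)
    (hδΔ : δ ≤ Δ) (hcard : ∀ v, δ ≤ (S v).card) (hcard' : ∀ v, (S v).card ≤ Δ + 1)
    (hdeg : ∀ x, (Finset.univ.filter fun v => x ∈ S v).card ≤ Δ + 1) :
    ∃ k : ℕ, 0 < k ∧ (k : ℝ) ≤ 880 * Real.log (4 * (Δ : ℝ)) * (Δ / δ) ∧
      ∀ L : V → Finset ℕ, (∀ v, (L v).card = k) →
        ∃ f : V → Option ℕ, RespectsLists L f ∧ ∀ v, HasUniqueColor f (S v : Set V) := by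
  set l := Real.log (4 * (Δ : ℝ)) with hl
  have hδ' : (1 : ℝ) ≤ δ := by exact_mod_cast hδ
  have hδΔ' : (δ : ℝ) ≤ Δ := by exact_mod_cast hδΔ
  have hΔ1 : (1 : ℝ) ≤ Δ := hδ'.trans hδΔ'
  have hl1 : 1 ≤ l := by
    rw [hl, Real.le_log_iff_exp_le (by positivity)]
    linarith [Real.exp_one_lt_d9]
  have hR : 1 ≤ (Δ : ℝ) / δ := by rw [one_le_div (by linarith)]; exact hδΔ'
  by_cases hsmall : (δ : ℝ) < 6 * l
  · refine ⟨Δ + 2, by omega, ?_, fun L hL => ?_⟩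
    · have h : (Δ : ℝ) ≤ 6 * l * (Δ / δ) := by
        rw [← mul_div_assoc, le_div_iff₀ (by positivity), mul_comm (Δ : ℝ)]
        gcongr
      have h' : 1 ≤ l * (Δ / δ) := one_le_mul_of_one_le_of_one_le hl1 hR
      push_cast
      nlinarith
    · exact exists_coloring_greedy S (Δ + 1)
        (fun v => Finset.card_pos.1 (hδ.trans (hcard v))) hdeg L (fun v => by rw [hL v]; omega)
  · push Not at hsmall
    have hq1 : 1 ≤ ⌊(δ : ℝ) / (6 * l)⌋₊ := by
      rw [Nat.one_le_floor_iff, one_le_div (by positivity)]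
      exact hsmall
    obtain ⟨n, hn⟩ := Nat.exists_eq_add_of_le' hq1
    have hfl := Nat.floor_le (by positivity : 0 ≤ (δ : ℝ) / (6 * l))
    have hfl' := Nat.lt_floor_add_one ((δ : ℝ) / (6 * l))
    rw [hn] at hfl hfl'
    push_cast at hfl hfl'
    rw [le_div_iff₀ (by positivity)] at hfl
    rw [div_lt_iff₀ (by positivity)] at hfl'
    set U := ⌈54 * l * ((Δ : ℝ) / δ)⌉₊ with hU
    have hU1 : 54 * l * ((Δ : ℝ) / δ) ≤ U := Nat.le_ceil _
    have hU2 : (U : ℝ) < 54 * l * ((Δ : ℝ) / δ) + 1 := Nat.ceil_lt_add_one (by positivity)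
    have h' : 1 ≤ l * (Δ / δ) := one_le_mul_of_one_le_of_one_le hl1 hR
    have hU0 : 0 < U := by
      have : (0 : ℝ) < U := by nlinarith
      exact_mod_cast this
    refine ⟨16 * U, by omega, ?_, fun L hL => ?_⟩
    · push_cast
      nlinarith
    · refine exists_coloring_of_prob_le S (Δ + 1) n (16 * U) U (by omega) (by omega) le_rfl hcard'
        hdeg (fun v => ?_) L hL
      refine failure_prob_le hδ hδΔ hl hl1 hfl ?_ hU1 (hcard v) (hcard' v)
      have h6 : 0 ≤ (n : ℝ) * (6 * l) := by positivity
      nlinarith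

/-! ### Choice numbers of graphs -/

theorem iInf_eq_coe_of_mem (P : ℕ → Prop) {k₀ : ℕ} (h0 : 0 < k₀) (h : P k₀) :
    ∃ k : ℕ, (⨅ (k : ℕ) (_ : 0 < k ∧ P k), (k : ℕ∞)) = k ∧ k ≤ k₀ := by
  have hle : (⨅ (k : ℕ) (_ : 0 < k ∧ P k), (k : ℕ∞)) ≤ k₀ := iInf₂_le k₀ ⟨h0, h⟩
  obtain ⟨k, hk⟩ := ENat.ne_top_iff_exists.1 (ne_top_of_le_ne_top (ENat.natCast_ne_top k₀) hle)
  exact ⟨k, hk.symm, by rw [← hk] at hle; exact_mod_cast hle⟩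

theorem exists_chONStar_eq {V : Type u} [Fintype V] (G : SimpleGraph V) [DecidableRel G.Adj]
    {δ : ℕ} (hδ : 1 ≤ δ) (hδΔ : δ ≤ G.maxDegree) (hdeg : ∀ v, δ ≤ G.degree v) :
    ∃ k : ℕ, chONStar G = k ∧
      (k : ℝ) ≤ 880 * Real.log (4 * (G.maxDegree : ℝ)) * (G.maxDegree / δ) := by
  classical
  obtain ⟨k₀, hk0, hk₀, h⟩ := exists_list_size (fun v => G.neighborFinset v) δ G.maxDegree hδ hδΔ
    hdeg (fun v => (G.degree_le_maxDegree v).trans (Nat.le_succ _))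
    (fun x => by
      refine le_trans (le_of_eq ?_) ((G.degree_le_maxDegree x).trans (Nat.le_succ _))
      rw [← SimpleGraph.card_neighborFinset_eq_degree]
      congr 1
      ext v
      simp [G.adj_comm])
  obtain ⟨k, hk, hkk⟩ := iInf_eq_coe_of_mem (IsCFONStarChoosable G) hk0 (fun L hL => by
    obtain ⟨f, hf, hu⟩ := h L hL
    exact ⟨f, hf, fun v => by simpa using hu v⟩)
  exact ⟨k, hk, le_trans (by exact_mod_cast hkk) hk₀⟩

theorem exists_chCNStar_eq {V : Type u} [Fintype V] (G : SimpleGraph V) [DecidableRel G.Adj]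
    {δ : ℕ} (hδ : 1 ≤ δ) (hδΔ : δ ≤ G.maxDegree) (hdeg : ∀ v, δ ≤ G.degree v + 1) :
    ∃ k : ℕ, chCNStar G = k ∧
      (k : ℝ) ≤ 880 * Real.log (4 * (G.maxDegree : ℝ)) * (G.maxDegree / δ) := by
  classical
  have hcard : ∀ v, (insert v (G.neighborFinset v)).card = G.degree v + 1 := fun v => by
    rw [Finset.card_insert_of_notMem (by simp), SimpleGraph.card_neighborFinset_eq_degree]
  obtain ⟨k₀, hk0, hk₀, h⟩ := exists_list_size (fun v => insert v (G.neighborFinset v)) δ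
    G.maxDegree hδ hδΔ
    (fun v => by rw [hcard]; exact hdeg v)
    (fun v => by rw [hcard]; exact Nat.succ_le_succ (G.degree_le_maxDegree v))
    (fun x => by
      refine le_trans (le_of_eq ?_) (Nat.succ_le_succ (G.degree_le_maxDegree x))
      rw [Nat.succ_eq_add_one, ← hcard x]
      congr 1
      ext v
      simp [G.adj_comm, eq_comm])
  obtain ⟨k, hk, hkk⟩ := iInf_eq_coe_of_mem (IsCFCNStarChoosable G) hk0 (fun L hL => by
    obtain ⟨f, hf, hu⟩ := h L hL
    exact ⟨f, hf, fun v => by simpa using hu v⟩)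
  exact ⟨k, hk, le_trans (by exact_mod_cast hkk) hk₀⟩

theorem log_four_mul_le {x : ℝ} (hx : 2 ≤ x) : Real.log (4 * x) ≤ 3 * Real.log x := by
  rw [show (3 : ℝ) * Real.log x = (3 : ℕ) * Real.log x by norm_num, ← Real.log_pow]
  exact Real.log_le_log (by positivity) (by nlinarith [mul_self_nonneg x])

end ListCF

theorem mainTheorem6 (c ε : ℝ) (hc : 0 < c) (hε : 0 ≤ ε) :
    ∃ C : ℝ, 0 < C ∧
      ∀ (V : Type u) [Fintype V] (G : SimpleGraph V) [DecidableRel G.Adj],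
        1 ≤ G.maxDegree →
        c * (G.maxDegree : ℝ) / Real.log (G.maxDegree : ℝ) ^ ε ≤ (G.minDegree : ℝ) →
        ((∀ v, 0 < G.degree v) →
          ∃ k : ℕ, ListCF.chONStar G = (k : ℕ∞) ∧
            (k : ℝ) ≤ 13088 / c * Real.log (4 * (G.maxDegree : ℝ)) ^ (1 + ε) + 866800 ∧
            (2 ≤ G.maxDegree → (k : ℝ) ≤ C * Real.log (G.maxDegree : ℝ) ^ (1 + ε))) ∧
        (∃ k : ℕ, ListCF.chCNStar G = (k : ℕ∞) ∧
            (k : ℝ) ≤ 13088 / c * Real.log (4 * (G.maxDegree : ℝ)) ^ (1 + ε) + 866800 ∧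
            (2 ≤ G.maxDegree → (k : ℝ) ≤ C * Real.log (G.maxDegree : ℝ) ^ (1 + ε))) := by
  refine ⟨880 / c * 3 ^ (1 + ε), by positivity, ?_⟩
  intro V _ G _ hΔ hdeg
  set Δ := G.maxDegree with hΔdef
  have hlog4 : 1 ≤ Real.log (4 * (Δ : ℝ)) := by
    have : (1 : ℝ) ≤ Δ := by exact_mod_cast hΔ
    rw [Real.le_log_iff_exp_le (by positivity)]
    linarith [Real.exp_one_lt_d9]
  have hpow0 : 0 ≤ 880 / c * Real.log (4 * (Δ : ℝ)) ^ (1 + ε) := by positivity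
  have hpow1 : 880 / c * Real.log (4 * (Δ : ℝ)) ^ (1 + ε) ≤
      13088 / c * Real.log (4 * (Δ : ℝ)) ^ (1 + ε) := by gcongr; norm_num
  rcases Nat.lt_or_ge Δ 2 with h2 | h2
  · -- `Δ = 1`: the degree condition may be void, but the additive constant is large enough.
    have h1 : Δ = 1 := by omega
    have hbound : 880 * Real.log (4 * (Δ : ℝ)) * (Δ / (1 : ℕ)) ≤
        13088 / c * Real.log (4 * (Δ : ℝ)) ^ (1 + ε) + 866800 := by
      have : Real.log (4 * (Δ : ℝ)) ≤ 3 := by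
        have := Real.log_le_sub_one_of_pos (by rw [h1]; norm_num : 0 < 4 * (Δ : ℝ))
        rw [h1] at this ⊢
        norm_num at this ⊢
        linarith
      have hone : (Δ : ℝ) / (1 : ℕ) = 1 := by rw [h1]; norm_num
      rw [hone]
      linarith
    constructor
    · intro hpos
      obtain ⟨k, hk, hkb⟩ := ListCF.exists_chONStar_eq G le_rfl hΔ hpos
      exact ⟨k, hk, hkb.trans hbound, fun h => by omega⟩
    · obtain ⟨k, hk, hkb⟩ := ListCF.exists_chCNStar_eq G le_rfl hΔ (fun v => by omega)
      exact ⟨k, hk, hkb.trans hbound, fun h => by omega⟩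
  · have hΔ2 : (2 : ℝ) ≤ Δ := by exact_mod_cast h2
    have hlog : 0 < Real.log (Δ : ℝ) := Real.log_pos (by linarith)
    have hlogle : Real.log (Δ : ℝ) ≤ Real.log (4 * (Δ : ℝ)) :=
      Real.log_le_log (by linarith) (by linarith)
    have hδpos : (0 : ℝ) < G.minDegree := lt_of_lt_of_le (by positivity) hdeg
    have hδ : 1 ≤ G.minDegree := by exact_mod_cast hδpos
    have hδΔ : G.minDegree ≤ Δ := G.minDegree_le_maxDegree
    have hratio : (Δ : ℝ) / G.minDegree ≤ Real.log (4 * (Δ : ℝ)) ^ ε / c := by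
      have h : (Δ : ℝ) / G.minDegree ≤ Real.log (Δ : ℝ) ^ ε / c := by
        rw [div_le_iff₀ (by positivity)] at hdeg
        rw [div_le_div_iff₀ hδpos hc]
        linarith
      exact h.trans (by gcongr)
    have hbound : 880 * Real.log (4 * (Δ : ℝ)) * (Δ / G.minDegree) ≤
        880 / c * Real.log (4 * (Δ : ℝ)) ^ (1 + ε) := by
      calc 880 * Real.log (4 * (Δ : ℝ)) * (Δ / G.minDegree)
          ≤ 880 * Real.log (4 * (Δ : ℝ)) * (Real.log (4 * (Δ : ℝ)) ^ ε / c) := by gcongr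
        _ = 880 / c * Real.log (4 * (Δ : ℝ)) ^ (1 + ε) := by
            rw [Real.rpow_add (by linarith), Real.rpow_one]; ring
    have hC : 880 / c * Real.log (4 * (Δ : ℝ)) ^ (1 + ε) ≤
        880 / c * 3 ^ (1 + ε) * Real.log (Δ : ℝ) ^ (1 + ε) := by
      rw [mul_assoc, ← Real.mul_rpow (by norm_num) hlog.le]
      have := ListCF.log_four_mul_le hΔ2
      gcongr
    constructor
    · intro _
      obtain ⟨k, hk, hkb⟩ := ListCF.exists_chONStar_eq G hδ hδΔ (G.minDegree_le_degree ·)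
      exact ⟨k, hk, by linarith, fun _ => by linarith⟩
    · obtain ⟨k, hk, hkb⟩ := ListCF.exists_chCNStar_eq G hδ hδΔ
        (fun v => (G.minDegree_le_degree v).trans (Nat.le_succ _))
      exact ⟨k, hk, by linarith, fun _ => by linarith⟩
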